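/- Let $M$ be a smooth manifold of dimension $n(k+1)$ with a $k$-symplectic structure: closed $2$-forms $\omega_1,\dots,\omega_k$ and an $nk$-dimensional foliation $\mathcal F$ with tangent distribution $L=T\mathcal F$, such that $C_x(\omega_1)\cap\cdots\cap C_x(\omega_k)=\{0\}$ for every $x\in M$, where $C_x(\omega)=\{v\in T_xM:\omega_x(v,w)=0\ \text{for all } w\in T_xM\}$, and $\omega_\alpha(X,X')=0$ for all $X,X'\in\Gamma(L)$ and all $\alpha$. Put $L_\alpha=L\cap\bigcap_{\beta\ne\alpha}C(\omega_\beta)$ (for $k\ge 2$ the intersection with $L$ is automatic; for $k=1$ this means $L_1=L$). Let $Q$ be an integrable distribution of rank $n$ with $TM=L\oplus Q$, tangent to a foliation $\mathcal G$, such that (i) $\omega_\alpha(Y,Y')=0$ for all $Y,Y'\in\Gamma(Q)$ and all $\alpha$; (ii) $[X,Y]\in\Gamma(L_\alpha\oplus Q)$ for all $\alpha$, $X\in\Gamma(L_\alpha)$, $Y\in\Gamma(Q)$; (iii) $(i_1^*)^{-1}(\psi_1^{YY'})=\cdots=(i_k^*)^{-1}(\psi_k^{YY'})$ for all $Y,Y'\in\Gamma(Q)$,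 where $i_\alpha^*:Q\to L_\alpha^*$ is the isomorphism $i_\alpha^*(Y)(X)=\omega_\alpha(Y,X)$ and $\psi_\alpha^{YY'}(V)=Y(\omega_\alpha(Y',V))-\omega_\alpha(Y',[Y,V])$. Let $\nabla$ be the canonical connection, that is, the linear connection on $M$ determined by the properties: (1) $\nabla L_\alpha\subset L_\alpha$ for every $\alpha$ and $\nabla Q\subset Q$; (2) $\nabla\omega_1=\cdots=\nabla\omega_k=0$; (3) its torsion $T$ satisfies $T(X,Y)=0$ for all $X\in\Gamma(L)$, $Y\in\Gamma(Q)$. Then $\nabla$ is torsion-free along the leaves of $\mathcal F$ and of $\mathcal G$: $T(X,X')=0$ for all $X,X'\in\Gamma(L)$, and $T(Y,Y')=0$ for all $Y,Y'\in\Gamma(Q)$. -/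

import Mathlib

open Set Bundle VectorField
open scoped Manifold ContDiff Topology

noncomputable section

namespace KSymp

variable {E : Type*} [NormedAddCommGroup E] [NormedSpace ℝ E]
  {M : Type*} [TopologicalSpace M] [ChartedSpace E M]

/-- A (not necessarily smooth) vector field on a manifold `M` modelled on `E`. -/
abbrev VField (E : Type*) [NormedAddCommGroup E] [NormedSpace ℝ E]
    (M : Type*) [TopologicalSpace M] [ChartedSpace E M] :=
  Π x : M, TangentSpace 𝓘(ℝ, E) x

/-- A field of linear subspaces of the tangent spaces. -/
abbrev Distr (E : Type*) [NormedAddCommGroup E] [NormedSpace ℝ E]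
    (M : Type*) [TopologicalSpace M] [ChartedSpace E M] :=
  Π x : M, Submodule ℝ (TangentSpace 𝓘(ℝ, E) x)

/-- A field of bilinear forms on the tangent spaces. -/
abbrev BilinField (E : Type*) [NormedAddCommGroup E] [NormedSpace ℝ E]
    (M : Type*) [TopologicalSpace M] [ChartedSpace E M] :=
  Π x : M, TangentSpace 𝓘(ℝ, E) x →L[ℝ] TangentSpace 𝓘(ℝ, E) x →L[ℝ] ℝ

/-- `X` is a smooth vector field on the set `U` (used for open `U`). -/
def SmoothOn [IsManifold 𝓘(ℝ, E) ∞ M] (X : VField E M) (U : Set M) : Prop :=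
  ContMDiffOn 𝓘(ℝ, E) (𝓘(ℝ, E).prod 𝓘(ℝ, E)) ∞
    (fun x => TotalSpace.mk' E (E := (TangentSpace 𝓘(ℝ, E) : M → Type _)) x (X x)) U

/-- `X` is a smooth section over the open set `U` of the distribution `D`. -/
structure IsSection [IsManifold 𝓘(ℝ, E) ∞ M] (D : Distr E M) (U : Set M) (X : VField E M) :
    Prop where
  isOpen : IsOpen U
  smooth : SmoothOn X U
  mem : ∀ x ∈ U, X x ∈ D x

/-- `D` is a smooth distribution of constant rank `r` which is integrable (involutive), i.e. the
tangent distribution of an `r`-dimensional foliation. -/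
structure IsIntegrable [IsManifold 𝓘(ℝ, E) ∞ M] (r : ℕ) (D : Distr E M) : Prop where
  finrank_eq : ∀ x, Module.finrank ℝ (D x) = r
  exists_frame : ∀ x, ∃ (U : Set M) (e : Fin r → VField E M), x ∈ U ∧
    (∀ i, IsSection D U (e i)) ∧ IsOpen U ∧
      ∀ y ∈ U, D y = Submodule.span ℝ (range fun i => e i y)
  involutive : ∀ (U : Set M) (X Y : VField E M), IsSection D U X → IsSection D U Y →
    ∀ x ∈ U, mlieBracket 𝓘(ℝ, E) X Y x ∈ D x

/-- The derivative `X(f)` at `x`. -/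
def lieD (X : VField E M) (f : M → ℝ) (x : M) : ℝ :=
  mvfderiv 𝓘(ℝ, E) f x (X x)

/-- The invariant formula for the exterior derivative of a `2`-form,
`dω(X,Y,Z) = X ω(Y,Z) + Y ω(Z,X) + Z ω(X,Y) - ω([X,Y],Z) - ω([Y,Z],X) - ω([Z,X],Y)`
(some authors put a factor `1/3` in front). -/
def extD (Ω : BilinField E M) (X Y Z : VField E M) (x : M) : ℝ :=
  lieD X (fun y => Ω y (Y y) (Z y)) x + lieD Y (fun y => Ω y (Z y) (X y)) x
    + lieD Z (fun y => Ω y (X y) (Y y)) x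
    - Ω x (mlieBracket 𝓘(ℝ, E) X Y x) (Z x) - Ω x (mlieBracket 𝓘(ℝ, E) Y Z x) (X x)
    - Ω x (mlieBracket 𝓘(ℝ, E) Z X x) (Y x)

/-- `Ω` is a smooth closed differential `2`-form. -/
structure IsClosedTwoForm [IsManifold 𝓘(ℝ, E) ∞ M] (Ω : BilinField E M) : Prop where
  alternating : ∀ x (v : TangentSpace 𝓘(ℝ, E) x), Ω x v v = 0
  smooth : ContMDiff 𝓘(ℝ, E) (𝓘(ℝ, E).prod 𝓘(ℝ, E →L[ℝ] E →L[ℝ] ℝ)) ∞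
    (fun x => TotalSpace.mk' (E →L[ℝ] E →L[ℝ] ℝ)
      (E := fun x : M => TangentSpace 𝓘(ℝ, E) x →L[ℝ] TangentSpace 𝓘(ℝ, E) x →L[ℝ] ℝ) x (Ω x))
  closed : ∀ (U : Set M) (X Y Z : VField E M), IsOpen U →
    SmoothOn X U → SmoothOn Y U → SmoothOn Z U → ∀ x ∈ U, extD Ω X Y Z x = 0

/-- The characteristic space `C_x(ω)` of `Ω` at `x`. -/
def charSpace (Ω : BilinField E M) (x : M) : Submodule ℝ (TangentSpace 𝓘(ℝ, E) x) :=
  LinearMap.ker (Ω x).toLinearMap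

/-- `(M, ω₁, …, ω_k, 𝓕)` is a `k`-symplectic manifold, where `L` is the tangent distribution of the
`nk`-dimensional foliation `𝓕` and `M` has dimension `n (k + 1)`. -/
structure IsKSymplectic [IsManifold 𝓘(ℝ, E) ∞ M] (n k : ℕ) (Ω : Fin k → BilinField E M)
    (L : Distr E M) : Prop where
  dim_eq : Module.finrank ℝ E = n * (k + 1)
  form : ∀ α, IsClosedTwoForm (Ω α)
  foliation : IsIntegrable (n * k) L
  char_inter : ∀ x, ⨅ α, charSpace (Ω α) x = ⊥
  isotropic : ∀ α x, ∀ u ∈ L x, ∀ v ∈ L x, Ω α x u v = 0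

/-- The distribution `L_α = L ∩ ⋂_{β ≠ α} C(ω_β)`. On a `k`-symplectic manifold with `k ≥ 2` the
intersection of the `C(ω_β)`, `β ≠ α`, already lies in `L`; for `k = 1` (empty intersection) this
reads `L₁ = L`. -/
def subL {k : ℕ} (Ω : Fin k → BilinField E M) (L : Distr E M) (α : Fin k) : Distr E M :=
  fun x => L x ⊓ ⨅ β : {β : Fin k // β ≠ α}, charSpace (Ω β.1) x

/-- `ψ^{YY'}(V) = (𝓛_Y i_{Y'} ω)(V) = Y(ω(Y',V)) - ω(Y',[Y,V])`. -/
def psi (Ω : BilinField E M) (Y Y' V : VField E M) (x : M) : ℝ :=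
  lieD Y (fun y => Ω y (Y' y) (V y)) x - Ω x (Y' x) (mlieBracket 𝓘(ℝ, E) Y V x)

/-- At the point `x`, the vector `h ∈ Q_x` is `(i_α^*)⁻¹(ψ_α^{YY'})`, where
`i_α^* : Q → L_α^*`, `i_α^*(Y)(X) = ω_α(Y,X)`. -/
def IsPsiDual [IsManifold 𝓘(ℝ, E) ∞ M] {k : ℕ} (Ω : Fin k → BilinField E M) (L Q : Distr E M)
    (α : Fin k) (Y Y' : VField E M) (x : M) (h : TangentSpace 𝓘(ℝ, E) x) : Prop :=
  h ∈ Q x ∧ ∀ (V : Set M) (X : VField E M), x ∈ V → IsSection (subL Ω L α) V X →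
    Ω α x h (X x) = psi (Ω α) Y Y' X x

/-- The assumptions on the transversal distribution `Q` (tangent to the foliation `𝓖`) under which
the canonical connection is defined. -/
structure IsAdmissible [IsManifold 𝓘(ℝ, E) ∞ M] (n : ℕ) {k : ℕ} (Ω : Fin k → BilinField E M)
    (L Q : Distr E M) : Prop where
  foliation : IsIntegrable n Q
  transversal : ∀ x, IsCompl (L x) (Q x)
  isotropic : ∀ α x, ∀ u ∈ Q x, ∀ v ∈ Q x, Ω α x u v = 0
  bracket : ∀ α (U : Set M) (X Y : VField E M), IsSection (subL Ω L α) U X → IsSection Q U Y →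
    ∀ x ∈ U, mlieBracket 𝓘(ℝ, E) X Y x ∈ subL Ω L α x ⊔ Q x
  psi_eq : ∀ (U : Set M) (Y Y' : VField E M), IsSection Q U Y → IsSection Q U Y' →
    ∀ x ∈ U, ∀ α β (h h' : TangentSpace 𝓘(ℝ, E) x),
      IsPsiDual Ω L Q α Y Y' x h → IsPsiDual Ω L Q β Y Y' x h' → h = h'

/-- A linear connection on the manifold `M`. In Mathlib, `cov W x (V x)` is `(∇_V W)(x)`. -/
abbrev Connection (E : Type*) [NormedAddCommGroup E] [NormedSpace ℝ E]
    (M : Type*) [TopologicalSpace M] [ChartedSpace E M] [IsManifold 𝓘(ℝ, E) ∞ M] :=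
  CovariantDerivative 𝓘(ℝ, E) E (TangentSpace 𝓘(ℝ, E) : M → Type _)

/-- `∇ D ⊂ D`. -/
def Preserves [IsManifold 𝓘(ℝ, E) ∞ M] (cov : Connection E M) (D : Distr E M) : Prop :=
  ∀ (U : Set M) (W : VField E M), IsSection D U W →
    ∀ x ∈ U, ∀ v : TangentSpace 𝓘(ℝ, E) x, cov W x v ∈ D x

/-- `∇ ω = 0`. -/
def IsParallel [IsManifold 𝓘(ℝ, E) ∞ M] (cov : Connection E M) (Ω : BilinField E M) : Prop :=
  ∀ (U : Set M) (V W W' : VField E M), IsOpen U → SmoothOn V U → SmoothOn W U → SmoothOn W' U →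
    ∀ x ∈ U, lieD V (fun y => Ω y (W y) (W' y)) x
      - Ω x (cov W x (V x)) (W' x) - Ω x (W x) (cov W' x (V x)) = 0

/-- `∇` is the canonical connection of `(M, ω_α, 𝓕, Q)`: the smooth linear connection determined by
the following three properties. -/
structure IsCanonical [FiniteDimensional ℝ E] [CompleteSpace E] [IsManifold 𝓘(ℝ, E) ∞ M] {k : ℕ}
    (Ω : Fin k → BilinField E M) (L Q : Distr E M) (cov : Connection E M) : Prop where
  smooth : ContMDiffCovariantDerivativeOn E ∞ cov.toFun univ
  preserves_subL : ∀ α, Preserves cov (subL Ω L α)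
  preserves_Q : Preserves cov Q
  parallel : ∀ α, IsParallel cov (Ω α)
  torsion_mixed : ∀ x, ∀ u ∈ L x, ∀ v ∈ Q x, cov.torsion x u v = 0

/-- `∇` is torsion-free along the leaves of the foliation with tangent distribution `D`. -/
def TorsionFreeAlong [FiniteDimensional ℝ E] [CompleteSpace E] [IsManifold 𝓘(ℝ, E) ∞ M]
    (cov : Connection E M) (D : Distr E M) : Prop :=
  ∀ x, ∀ u ∈ D x, ∀ v ∈ D x, cov.torsion x u v = 0

end KSymp

end

namespace KSymp

variable {E : Type*} [NormedAddCommGroup E] [NormedSpace ℝ E]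
  {M : Type*} [TopologicalSpace M] [ChartedSpace E M]

/-! For a closed form ω parallel for ∇, the cyclic sum of ω(T(X,Y),Z) vanishes
(`IsParallel.cyclic_torsion`). If X, Y are tangent to one foliation and Z to the other, two of the
three terms contain mixed torsion, so ω_γ(T(X,Y),Z) = 0 for every γ. Invariance and involutivity
keep T(X,Y) in the same distribution as X and Y. That distribution is isotropic, so T(X,Y) lies in
every C(ω_γ), hence is zero.

On Q this applies directly. On L, invariance is known only for sections of the L_α, so smooth local
sections of these must be produced and shown to span L (`exists_section_subL`,
`exists_sections_sum_eq`). They come from inverting the matrix pairing L with k copies of Q, which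
is smooth by Cramer's rule. -/

lemma contMDiffOn_det {ι : Type*} [Fintype ι] [DecidableEq ι] {A : M → Matrix ι ι ℝ} {U : Set M}
    (hA : ∀ i j, ContMDiffOn 𝓘(ℝ, E) 𝓘(ℝ) ∞ (fun y => A y i j) U) :
    ContMDiffOn 𝓘(ℝ, E) 𝓘(ℝ) ∞ (fun y => (A y).det) U := by
  simp only [Matrix.det_apply']
  exact contMDiffOn_finsetSum fun σ _ =>
    contMDiffOn_const.mul (contMDiffOn_finsetProd fun i _ => hA (σ i) i)

lemma contMDiffOn_matrix_inv {ι : Type*} [Fintype ι] [DecidableEq ι] {A : M → Matrix ι ι ℝ}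
    {U : Set M} (hA : ∀ i j, ContMDiffOn 𝓘(ℝ, E) 𝓘(ℝ) ∞ (fun y => A y i j) U)
    (hdet : ∀ y ∈ U, (A y).det ≠ 0) (i j : ι) :
    ContMDiffOn 𝓘(ℝ, E) 𝓘(ℝ) ∞ (fun y => (A y)⁻¹ i j) U := by
  simp only [Matrix.inv_def, Ring.inverse_eq_inv', Matrix.smul_apply, smul_eq_mul,
    Matrix.adjugate_apply]
  refine ((contMDiffOn_det hA).inv₀ hdet).mul (contMDiffOn_det fun a b => ?_)
  -- The adjugate entry is the determinant of A with row j replaced by a constant basis vector.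
  by_cases h : a = j
  · subst h
    simpa using contMDiffOn_const
  · simpa [Matrix.updateRow_ne h] using hA a b

lemma forall_apply_eq_of_span {r : ℕ} {D : Distr E M} {θ : BilinField E M} {x : M}
    {f : Fin r → TangentSpace 𝓘(ℝ, E) x} (hf : D x = Submodule.span ℝ (range f))
    {w w' : TangentSpace 𝓘(ℝ, E) x} (h : ∀ j, θ x w (f j) = θ x w' (f j)) :
    ∀ v ∈ D x, θ x w v = θ x w' v := by
  intro v hv
  rw [hf] at hv
  induction hv using Submodule.span_induction with
  | mem v hv => obtain ⟨j, rfl⟩ := hv; exact h j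
  | zero => simp
  | add a b _ _ ha hb => simp [ha, hb]
  | smul c a _ ha => simp [ha]

variable [IsManifold 𝓘(ℝ, E) ∞ M]

lemma SmoothOn.mono {X : VField E M} {U V : Set M} (h : SmoothOn X U) (hVU : V ⊆ U) :
    SmoothOn X V :=
  ContMDiffOn.mono h hVU

lemma SmoothOn.mdifferentiableAt {X : VField E M} {U : Set M} (h : SmoothOn X U) (hU : IsOpen U)
    {x : M} (hx : x ∈ U) : MDiffAt (T% X) x :=
  (h.contMDiffAt (hU.mem_nhds hx)).mdifferentiableAt (by simp)

lemma SmoothOn.sum_smul {ι : Type*} [Fintype ι] {e : ι → VField E M} {c : ι → M → ℝ} {U : Set M}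
    (he : ∀ i, SmoothOn (e i) U) (hc : ∀ i, ContMDiffOn 𝓘(ℝ, E) 𝓘(ℝ) ∞ (c i) U) :
    SmoothOn (fun y => ∑ i, c i y • e i y) U :=
  ContMDiffOn.sum_section fun i _ => (hc i).smul_section (he i)

lemma IsClosedTwoForm.contMDiffOn_apply {Ω : BilinField E M} (hΩ : IsClosedTwoForm Ω)
    {X Y : VField E M} {U : Set M} (hX : SmoothOn X U) (hY : SmoothOn Y U) :
    ContMDiffOn 𝓘(ℝ, E) 𝓘(ℝ) ∞ (fun y => Ω y (X y) (Y y)) U := by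
  have h : ContMDiffOn 𝓘(ℝ, E) (𝓘(ℝ, E).prod 𝓘(ℝ)) ∞
      (fun y => TotalSpace.mk' ℝ (E := Bundle.Trivial M ℝ) y (Ω y (X y) (Y y))) U :=
    ContMDiffOn.clm_bundle_apply₂ (E₃ := Bundle.Trivial M ℝ) hΩ.smooth.contMDiffOn hX hY
  intro x hx
  exact ((contMDiffWithinAt_totalSpace.1 (h x hx)).2)

lemma IsSection.mono {D : Distr E M} {U V : Set M} {X : VField E M} (h : IsSection D U X)
    (hV : IsOpen V) (hVU : V ⊆ U) : IsSection D V X :=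
  ⟨hV, h.smooth.mono hVU, fun x hx => h.mem x (hVU hx)⟩

lemma IsIntegrable.exists_section {r : ℕ} {D : Distr E M} (h : IsIntegrable r D) {x : M}
    {u : TangentSpace 𝓘(ℝ, E) x} (hu : u ∈ D x) :
    ∃ (U : Set M) (X : VField E M), x ∈ U ∧ IsSection D U X ∧ X x = u := by
  obtain ⟨U, e, hxU, he, hU, hspan⟩ := h.exists_frame x
  rw [hspan x hxU] at hu
  obtain ⟨c, hc⟩ := (Submodule.mem_span_range_iff_exists_fun ℝ).1 hu
  refine ⟨U, fun y => ∑ i, c i • e i y, hxU, ⟨hU, ?_, ?_⟩, hc⟩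
  · exact SmoothOn.sum_smul (c := fun i _ => c i) (fun i => (he i).smooth)
      fun i => contMDiffOn_const
  · exact fun y hy => Submodule.sum_mem _ fun i _ => Submodule.smul_mem _ _ ((he i).mem y hy)

lemma IsClosedTwoForm.neg_swap {Ω : BilinField E M} (hΩ : IsClosedTwoForm Ω) (x : M)
    (v w : TangentSpace 𝓘(ℝ, E) x) : Ω x v w = -Ω x w v := by
  have h := hΩ.alternating x (v + w)
  simp only [map_add, add_apply, hΩ.alternating] at h
  linarith

/-- The first Bianchi identity for a closed form which is parallel for a connection with torsion. -/
lemma IsParallel.cyclic_torsion [FiniteDimensional ℝ E] [CompleteSpace E] {Ω : BilinField E M}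
    {cov : Connection E M} (hpar : IsParallel cov Ω) (hΩ : IsClosedTwoForm Ω) {U : Set M}
    (hU : IsOpen U) {X Y Z : VField E M} (hX : SmoothOn X U) (hY : SmoothOn Y U)
    (hZ : SmoothOn Z U) {x : M} (hx : x ∈ U) :
    Ω x (cov.torsion x (X x) (Y x)) (Z x) + Ω x (cov.torsion x (Y x) (Z x)) (X x)
      + Ω x (cov.torsion x (Z x) (X x)) (Y x) = 0 := by
  have hX' := hX.mdifferentiableAt hU hx
  have hY' := hY.mdifferentiableAt hU hx
  have hZ' := hZ.mdifferentiableAt hU hx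
  rw [cov.torsion_apply hX' hY', cov.torsion_apply hY' hZ', cov.torsion_apply hZ' hX']
  simp only [map_sub, sub_apply]
  have h := hΩ.closed U X Y Z hU hX hY hZ x hx
  unfold extD at h
  -- ∇ω = 0, taken over the three cyclic orders, replaces each derivative in dω by covariant ones;
  -- the brackets then complete the torsions.
  have h1 := hpar U X Y Z hU hX hY hZ x hx
  have h2 := hpar U Y Z X hU hY hZ hX x hx
  have h3 := hpar U Z X Y hU hZ hX hY x hx
  rw [hΩ.neg_swap x (Y x)] at h1
  rw [hΩ.neg_swap x (Z x)] at h2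
  rw [hΩ.neg_swap x (X x)] at h3
  linarith

/-! ### Nondegeneracy of the pairing and local sections of L_α -/

section Transversal

variable {n k : ℕ} {Ω : Fin k → BilinField E M} {L Q : Distr E M}

lemma eq_zero_of_forall_apply_eq_zero (hM : IsKSymplectic n k Ω L) (hQ : IsAdmissible n Ω L Q)
    {x : M} {w : TangentSpace 𝓘(ℝ, E) x} (hL : ∀ α, ∀ v ∈ L x, Ω α x w v = 0)
    (hQ' : ∀ α, ∀ v ∈ Q x, Ω α x w v = 0) : w = 0 := by
  rw [← Submodule.mem_bot ℝ, ← hM.char_inter x, Submodule.mem_iInf]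
  intro α
  refine LinearMap.mem_ker.2 (ContinuousLinearMap.ext fun v => ?_)
  obtain ⟨a, ha, b, hb, rfl⟩ :=
    Submodule.mem_sup.1 ((hQ.transversal x).sup_eq_top ▸ Submodule.mem_top : v ∈ L x ⊔ Q x)
  have : Ω α x w (a + b) = 0 := by rw [map_add, hL α a ha, hQ' α b hb, add_zero]
  exact this

lemma eq_zero_of_mem_left (hM : IsKSymplectic n k Ω L) (hQ : IsAdmissible n Ω L Q)
    {x : M} {w : TangentSpace 𝓘(ℝ, E) x} (hw : w ∈ L x)
    (h : ∀ α, ∀ v ∈ Q x, Ω α x w v = 0) : w = 0 :=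
  eq_zero_of_forall_apply_eq_zero hM hQ (fun α v hv => hM.isotropic α x w hw v hv) h

lemma eq_zero_of_mem_right (hM : IsKSymplectic n k Ω L) (hQ : IsAdmissible n Ω L Q)
    {x : M} {w : TangentSpace 𝓘(ℝ, E) x} (hw : w ∈ Q x)
    (h : ∀ α, ∀ v ∈ L x, Ω α x w v = 0) : w = 0 :=
  eq_zero_of_forall_apply_eq_zero hM hQ h (fun α v hv => hQ.isotropic α x w hw v hv)

/-- Isotropy of L leaves only the Q-directions of TM = L ⊕ Q to test. -/
lemma mem_subL_of_forall (hM : IsKSymplectic n k Ω L) (hQ : IsAdmissible n Ω L Q)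
    {α : Fin k} {x : M} {w : TangentSpace 𝓘(ℝ, E) x} (hw : w ∈ L x)
    (h : ∀ β ≠ α, ∀ v ∈ Q x, Ω β x w v = 0) : w ∈ subL Ω L α x := by
  refine ⟨hw, (Submodule.mem_iInf _).2 fun β => ?_⟩
  refine LinearMap.mem_ker.2 (ContinuousLinearMap.ext fun v => ?_)
  obtain ⟨a, ha, b, hb, rfl⟩ :=
    Submodule.mem_sup.1 ((hQ.transversal x).sup_eq_top ▸ Submodule.mem_top : v ∈ L x ⊔ Q x)
  have : Ω β.1 x w (a + b) = 0 := by
    rw [map_add, hM.isotropic _ x w hw a ha, h β.1 β.2 b hb, add_zero]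
  exact this

/-- The matrix of the pairing `L × Q^k → ℝ` given by the forms is invertible. -/
lemma det_pairing_ne_zero (hM : IsKSymplectic n k Ω L) (hQ : IsAdmissible n Ω L Q) {x : M}
    {e : Fin (n * k) → TangentSpace 𝓘(ℝ, E) x} (he : L x = Submodule.span ℝ (range e))
    {f : Fin n → TangentSpace 𝓘(ℝ, E) x} (hf : Q x = Submodule.span ℝ (range f))
    (σ : Fin k × Fin n ≃ Fin (n * k)) :
    (Matrix.of fun p q : Fin k × Fin n => Ω q.1 x (e (σ p)) (f q.2)).det ≠ 0 := by
  intro hdet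
  obtain ⟨c, hc0, hc⟩ := Matrix.exists_vecMul_eq_zero_iff.2 hdet
  apply hc0
  -- L has rank nk, so these nk spanning vectors form a basis; a left kernel vector c would give a
  -- combination that every form annihilates on Q.
  have hli : LinearIndependent ℝ (e ∘ σ) := by
    refine (linearIndependent_equiv σ).2 ?_
    rw [linearIndependent_iff_card_eq_finrank_span, Set.finrank, ← he,
      hM.foliation.finrank_eq x, Fintype.card_fin]
  have hsum : ∑ p, c p • e (σ p) = 0 := by
    refine eq_zero_of_mem_left hM hQ (Submodule.sum_mem _ fun p _ => Submodule.smul_mem _ _ ?_) ?_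
    · rw [he]; exact Submodule.subset_span ⟨_, rfl⟩
    · intro β v hv
      have := forall_apply_eq_of_span (θ := Ω β) (w' := 0) hf (w := ∑ p, c p • e (σ p))
        (fun j => ?_) v hv
      · simpa using this
      · have := congrFun hc (β, j)
        simpa [Matrix.vecMul, dotProduct, sum_apply] using this
  exact funext fun p => Fintype.linearIndependent_iff.1 hli c hsum p

/-- For every vector `u` there is a local section of `L_α` pairing with `Q` under `ω_α` as `u` does. -/
lemma exists_section_subL (hM : IsKSymplectic n k Ω L) (hQ : IsAdmissible n Ω L Q) (α : Fin k)
    {x : M} (u : TangentSpace 𝓘(ℝ, E) x) :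
    ∃ (U : Set M) (X : VField E M), x ∈ U ∧ IsSection (subL Ω L α) U X ∧
      ∀ v ∈ Q x, Ω α x (X x) v = Ω α x u v := by
  obtain ⟨U₁, e, hxU₁, he, hU₁, hspan₁⟩ := hM.foliation.exists_frame x
  obtain ⟨U₂, f, hxU₂, hf, hU₂, hspan₂⟩ := hQ.foliation.exists_frame x
  let σ : Fin k × Fin n ≃ Fin (n * k) :=
    Fintype.equivOfCardEq (by simp [mul_comm])
  let A : M → Matrix (Fin k × Fin n) (Fin k × Fin n) ℝ := fun y =>
    Matrix.of fun p q => Ω q.1 y (e (σ p) y) (f q.2 y)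
  -- The prescribed pairings of X with the frame of Q, held constant in y: zero for β ≠ α keeps X in
  -- L_α on the whole neighbourhood, while ω_α agrees with u at x.
  let b : Fin k × Fin n → ℝ := fun q => if q.1 = α then Ω α x u (f q.2 x) else 0
  let c : Fin k × Fin n → M → ℝ := fun p y => Matrix.vecMul b (A y)⁻¹ p
  let X : VField E M := fun y => ∑ p, c p y • e (σ p) y
  have hU : IsOpen (U₁ ∩ U₂) := hU₁.inter hU₂
  have he' : ∀ p, SmoothOn (e (σ p)) (U₁ ∩ U₂) := fun p => (he _).smooth.mono inter_subset_left
  have hf' : ∀ j, SmoothOn (f j) (U₁ ∩ U₂) := fun j => (hf _).smooth.mono inter_subset_right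
  have hdet : ∀ y ∈ U₁ ∩ U₂, (A y).det ≠ 0 := fun y hy =>
    det_pairing_ne_zero hM hQ (hspan₁ y hy.1) (hspan₂ y hy.2) σ
  have hA : ∀ p q, ContMDiffOn 𝓘(ℝ, E) 𝓘(ℝ) ∞ (fun y => A y p q) (U₁ ∩ U₂) := fun p q =>
    (hM.form q.1).contMDiffOn_apply (he' p) (hf' q.2)
  have hc : ∀ p, ContMDiffOn 𝓘(ℝ, E) 𝓘(ℝ) ∞ (c p) (U₁ ∩ U₂) := fun p =>
    contMDiffOn_finsetSum (f := fun q y => b q * (A y)⁻¹ q p)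
      fun q _ => contMDiffOn_const.mul (contMDiffOn_matrix_inv hA hdet q p)
  have hpair : ∀ y ∈ U₁ ∩ U₂, ∀ β j, Ω β y (X y) (f j y) = b (β, j) := by
    intro y hy β j
    have h : Matrix.vecMul (Matrix.vecMul b (A y)⁻¹) (A y) = b := by
      rw [Matrix.vecMul_vecMul, Matrix.nonsing_inv_mul _ (isUnit_iff_ne_zero.2 (hdet y hy)),
        Matrix.vecMul_one]
    rw [← congrFun h (β, j)]
    simp [X, c, A, Matrix.vecMul, dotProduct, sum_apply]
  refine ⟨U₁ ∩ U₂, X, ⟨hxU₁, hxU₂⟩, ⟨hU, SmoothOn.sum_smul he' hc, fun y hy => ?_⟩, ?_⟩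
  · refine mem_subL_of_forall hM hQ
      (Submodule.sum_mem _ fun p _ => Submodule.smul_mem _ _ ((he _).mem y hy.1)) ?_
    intro β hβ v hv
    have := forall_apply_eq_of_span (θ := Ω β) (w := X y) (w' := 0) (hspan₂ y hy.2)
      (fun j => by rw [hpair y hy]; simp [b, hβ]) v hv
    simpa using this
  · exact forall_apply_eq_of_span (hspan₂ x hxU₂)
      fun j => by rw [hpair x ⟨hxU₁, hxU₂⟩]; simp [b]

/-- Every vector of `L` is a sum of values of local sections of the `L_α`. -/
lemma exists_sections_sum_eq (hM : IsKSymplectic n k Ω L) (hQ : IsAdmissible n Ω L Q)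
    {x : M} {u : TangentSpace 𝓘(ℝ, E) x} (hu : u ∈ L x) :
    ∃ (U : Fin k → Set M) (X : Fin k → VField E M),
      (∀ α, x ∈ U α ∧ IsSection (subL Ω L α) (U α) (X α)) ∧ ∑ α, X α x = u := by
  choose U X hxU hX hXu using fun α => exists_section_subL hM hQ α u
  refine ⟨U, X, fun α => ⟨hxU α, hX α⟩, ?_⟩
  have hmem := fun α => (hX α).mem x (hxU α)
  rw [← sub_eq_zero]
  refine eq_zero_of_mem_left hM hQ
    (Submodule.sub_mem _ (Submodule.sum_mem _ fun α _ => (hmem α).1) hu) fun β v hv => ?_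
  -- Under ω_β only the β-th summand survives, and it pairs with Q as u does.
  have h0 : ∀ α ≠ β, Ω β x (X α x) v = 0 := fun α hα => by
    have := (Submodule.mem_iInf _).1 (hmem α).2 ⟨β, hα.symm⟩
    exact DFunLike.congr_fun (LinearMap.mem_ker.1 this) v
  rw [map_sub, map_sum, sub_apply, sum_apply,
    Finset.sum_eq_single β (fun α _ hα => h0 α hα) (by simp), hXu β v hv, sub_self]

/-! ### Vanishing of the torsion along the leaves -/

variable [FiniteDimensional ℝ E] [CompleteSpace E] {cov : Connection E M}

/-- α and β may differ: the covariant derivatives stay in L_β and L_α, the bracket only in L, and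
membership in L is enough for nondegeneracy against Q. -/
lemma IsCanonical.torsion_sections_left (hM : IsKSymplectic n k Ω L) (hQ : IsAdmissible n Ω L Q)
    (hcov : IsCanonical Ω L Q cov) {α β : Fin k} {U V : Set M} {X Y : VField E M}
    (hX : IsSection (subL Ω L α) U X) (hY : IsSection (subL Ω L β) V Y) {x : M} (hxU : x ∈ U)
    (hxV : x ∈ V) : cov.torsion x (X x) (Y x) = 0 := by
  have hLX : IsSection L U X := ⟨hX.isOpen, hX.smooth, fun y hy => (hX.mem y hy).1⟩
  have hLY : IsSection L V Y := ⟨hY.isOpen, hY.smooth, fun y hy => (hY.mem y hy).1⟩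
  have hUV := hX.isOpen.inter hY.isOpen
  refine eq_zero_of_mem_left hM hQ ?_ fun γ v hv => ?_
  · rw [cov.torsion_apply (hX.smooth.mdifferentiableAt hX.isOpen hxU)
      (hY.smooth.mdifferentiableAt hY.isOpen hxV)]
    refine Submodule.sub_mem _ (Submodule.sub_mem _ ?_ ?_) ?_
    · exact (hcov.preserves_subL β V Y hY x hxV _).1
    · exact (hcov.preserves_subL α U X hX x hxU _).1
    · exact hM.foliation.involutive _ X Y (hLX.mono hUV inter_subset_left)
        (hLY.mono hUV inter_subset_right) x ⟨hxU, hxV⟩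
  · obtain ⟨W, Z, hxW, hZ, rfl⟩ := hQ.foliation.exists_section hv
    have h := (hcov.parallel γ).cyclic_torsion (hM.form γ) (hUV.inter hZ.isOpen)
      (hX.smooth.mono fun y hy => hy.1.1) (hY.smooth.mono fun y hy => hy.1.2)
      (hZ.smooth.mono fun y hy => hy.2) (x := x) ⟨⟨hxU, hxV⟩, hxW⟩
    rw [hcov.torsion_mixed x _ (hLY.mem x hxV) _ hv, cov.torsion_antisymm (Z x),
      hcov.torsion_mixed x _ (hLX.mem x hxU) _ hv] at h
    simpa using h

/-- Torsion is tensorial and bilinear, so values of sections of the L_α suffice. -/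
lemma IsCanonical.torsionFreeAlong_left (hM : IsKSymplectic n k Ω L) (hQ : IsAdmissible n Ω L Q)
    (hcov : IsCanonical Ω L Q cov) : TorsionFreeAlong cov L := by
  intro x u hu v hv
  obtain ⟨U, X, hX, rfl⟩ := exists_sections_sum_eq hM hQ hu
  obtain ⟨V, Y, hY, rfl⟩ := exists_sections_sum_eq hM hQ hv
  simp only [map_sum, sum_apply]
  exact Finset.sum_eq_zero fun β _ => Finset.sum_eq_zero fun α _ =>
    hcov.torsion_sections_left hM hQ (hX _).2 (hY _).2 (hX _).1 (hY _).1

lemma IsCanonical.torsionFreeAlong_right (hM : IsKSymplectic n k Ω L) (hQ : IsAdmissible n Ω L Q)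
    (hcov : IsCanonical Ω L Q cov) : TorsionFreeAlong cov Q := by
  intro x u hu v hv
  obtain ⟨U, X, hxU, hX, rfl⟩ := hQ.foliation.exists_section hu
  obtain ⟨V, Y, hxV, hY, rfl⟩ := hQ.foliation.exists_section hv
  have hUV := hX.isOpen.inter hY.isOpen
  refine eq_zero_of_mem_right hM hQ ?_ fun γ w hw => ?_
  · rw [cov.torsion_apply (hX.smooth.mdifferentiableAt hX.isOpen hxU)
      (hY.smooth.mdifferentiableAt hY.isOpen hxV)]
    refine Submodule.sub_mem _ (Submodule.sub_mem _ ?_ ?_) ?_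
    · exact hcov.preserves_Q V Y hY x hxV _
    · exact hcov.preserves_Q U X hX x hxU _
    · exact hQ.foliation.involutive _ X Y (hX.mono hUV inter_subset_left)
        (hY.mono hUV inter_subset_right) x ⟨hxU, hxV⟩
  · obtain ⟨W, Z, hxW, hZ, rfl⟩ := hM.foliation.exists_section hw
    have h := (hcov.parallel γ).cyclic_torsion (hM.form γ) (hUV.inter hZ.isOpen)
      (hX.smooth.mono fun y hy => hy.1.1) (hY.smooth.mono fun y hy => hy.1.2)
      (hZ.smooth.mono fun y hy => hy.2) (x := x) ⟨⟨hxU, hxV⟩, hxW⟩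
    rw [cov.torsion_antisymm (Y x), hcov.torsion_mixed x _ hw _ hv,
      hcov.torsion_mixed x _ hw _ hu] at h
    simpa using h

end Transversal

end KSymp

theorem mainTheorem7 (n k : ℕ)
    {E : Type*} [NormedAddCommGroup E] [NormedSpace ℝ E] [FiniteDimensional ℝ E] [CompleteSpace E]
    {M : Type*} [TopologicalSpace M] [T2Space M] [SecondCountableTopology M]
    [ChartedSpace E M] [IsManifold 𝓘(ℝ, E) ∞ M]
    (Ω : Fin k → KSymp.BilinField E M) (L Q : KSymp.Distr E M)
    (hM : KSymp.IsKSymplectic n k Ω L) (hQ : KSymp.IsAdmissible n Ω L Q)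
    (cov : KSymp.Connection E M) (hcov : KSymp.IsCanonical Ω L Q cov) :
    KSymp.TorsionFreeAlong cov L ∧ KSymp.TorsionFreeAlong cov Q := by
  exact ⟨hcov.torsionFreeAlong_left hM hQ, hcov.torsionFreeAlong_right hM hQ⟩
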